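/- Let $k$ be a field. For a finite-dimensional $k$-algebra $A$ and positive integers $m,n$, call $A$ \emph{$(m,n)$-almost hereditary} if $\operatorname{gl.dim}A=m+n$ and every indecomposable finitely generated left $A$-module $X$ satisfies $\operatorname{pd}_A X\le m$ or $\operatorname{id}_A X\le n$. For a finite-dimensional $k$-algebra $B$ and a finitely generated left $B$-module $M$, the \emph{one-point extension} is the matrix algebra $$B[M]=\begin{pmatrix} B & M\\ 0 & k\end{pmatrix}.$$ Its finitely generated left modules are, up to isomorphism, the triples $(k^t,X,f)$ with $t\ge 0$ an integer, $X$ a finitely generated left $B$-module and $f\colon M\otimes_k k^t\to X$ a $B$-linear map, where $\begin{pmatrix} b & a\\ 0 & c\end{pmatrix}$ sends $(v,x)\in k^t\times X$ to $(cv,\;bx+f(a\otimes v))$. Theorem. Let $m$ be a positive integer, let $B$ be an $(m,1)$-almost hereditary finite-dimensional $k$-algebra and let $M$ be a finitely generated projective left $B$-module. Suppose that for every indecomposable $B[M]$-module $(k^t,X,f)$ one has $\operatorname{pd}_B X\le m$ or $\operatorname{id}_B X\le 1$. Then $B[M]$ is $(m,1)$-almost hereditary. -/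

import Mathlib

universe u

open CategoryTheory TensorProduct

/-- The (left) global dimension of a ring: the supremum of the projective dimensions of its
(left) modules. -/
noncomputable def globalDimension (A : Type u) [Ring A] : WithBot ℕ∞ :=
  ⨆ X : ModuleCat.{u} A, projectiveDimension X

/-- An algebra `A`, finitely generated as a module over `k`, is `(m, n)`-almost hereditary (for
positive integers `m` and `n`) if its global dimension is `m + n` and every finitely generated
indecomposable left `A`-module has projective dimension at most `m` or injective dimension at
most `n`. -/
structure IsAlmostHereditary (k A : Type u) [CommRing k] [Ring A] [Algebra k A] (m n : ℕ) :
    Prop where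
  finite : Module.Finite k A
  globalDimension_eq : globalDimension A = (m + n : ℕ)
  dimension_le : ∀ X : ModuleCat.{u} A, Module.Finite A X → Indecomposable X →
    projectiveDimension X ≤ m ∨ injectiveDimension X ≤ n

/-- The one-point extension `B[M]` of the `k`-algebra `B` by the left `B`-module `M`: the algebra
of matrices with first row `(base, off)` in `B × M` and second row `(0, pt)`, `pt ∈ k`. -/
@[ext]
structure OnePointExtension (k B M : Type u) : Type u where
  base : B
  off : M
  pt : k

set_option linter.unusedSectionVars false

namespace OnePointExtension

section Algebra

variable {k B M : Type u} [Field k] [Ring B] [Algebra k B] [AddCommGroup M] [Module k M]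
  [Module B M]

instance : Zero (OnePointExtension k B M) := ⟨⟨0, 0, 0⟩⟩
instance : One (OnePointExtension k B M) := ⟨⟨1, 0, 1⟩⟩
instance : Add (OnePointExtension k B M) :=
  ⟨fun x y => ⟨x.base + y.base, x.off + y.off, x.pt + y.pt⟩⟩
instance : Neg (OnePointExtension k B M) := ⟨fun x => ⟨-x.base, -x.off, -x.pt⟩⟩

/-- Matrix multiplication, where `k` acts on `M` from the right. -/
instance : Mul (OnePointExtension k B M) :=
  ⟨fun x y => ⟨x.base * y.base, x.base • y.off + y.pt • x.off, x.pt * y.pt⟩⟩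

instance : SMul k (OnePointExtension k B M) :=
  ⟨fun c x => ⟨c • x.base, c • x.off, c * x.pt⟩⟩

@[simp] theorem zero_base : (0 : OnePointExtension k B M).base = 0 := rfl
@[simp] theorem zero_off : (0 : OnePointExtension k B M).off = 0 := rfl
@[simp] theorem zero_pt : (0 : OnePointExtension k B M).pt = 0 := rfl
@[simp] theorem one_base : (1 : OnePointExtension k B M).base = 1 := rfl
@[simp] theorem one_off : (1 : OnePointExtension k B M).off = 0 := rfl
@[simp] theorem one_pt : (1 : OnePointExtension k B M).pt = 1 := rfl
@[simp] theorem add_base (x y : OnePointExtension k B M) :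
    (x + y).base = x.base + y.base := rfl
@[simp] theorem add_off (x y : OnePointExtension k B M) : (x + y).off = x.off + y.off := rfl
@[simp] theorem add_pt (x y : OnePointExtension k B M) : (x + y).pt = x.pt + y.pt := rfl
@[simp] theorem neg_base (x : OnePointExtension k B M) : (-x).base = -x.base := rfl
@[simp] theorem neg_off (x : OnePointExtension k B M) : (-x).off = -x.off := rfl
@[simp] theorem neg_pt (x : OnePointExtension k B M) : (-x).pt = -x.pt := rfl
@[simp] theorem mul_base (x y : OnePointExtension k B M) :
    (x * y).base = x.base * y.base := rfl
@[simp] theorem mul_off (x y : OnePointExtension k B M) :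
    (x * y).off = x.base • y.off + y.pt • x.off := rfl
@[simp] theorem mul_pt (x y : OnePointExtension k B M) : (x * y).pt = x.pt * y.pt := rfl
@[simp] theorem smul_base (c : k) (x : OnePointExtension k B M) :
    (c • x).base = c • x.base := rfl
@[simp] theorem smul_off (c : k) (x : OnePointExtension k B M) : (c • x).off = c • x.off := rfl
@[simp] theorem smul_pt (c : k) (x : OnePointExtension k B M) : (c • x).pt = c * x.pt := rfl

variable [IsScalarTower k B M]

instance : Ring (OnePointExtension k B M) where
  add_assoc x y z := by ext <;> simp [add_assoc]
  zero_add x := by ext <;> simp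
  add_zero x := by ext <;> simp
  add_comm x y := by ext <;> simp [add_comm]
  neg_add_cancel x := by ext <;> simp
  nsmul := nsmulRec
  zsmul := zsmulRec
  zero_mul x := by ext <;> simp
  mul_zero x := by ext <;> simp
  one_mul x := by ext <;> simp
  mul_one x := by ext <;> simp
  left_distrib x y z := by
    ext
    · simp [mul_add]
    · simp only [mul_off, add_off, add_pt, smul_add, add_smul]; abel
    · simp [mul_add]
  right_distrib x y z := by
    ext
    · simp [add_mul]
    · simp only [mul_off, add_off, add_base, smul_add, add_smul]; abel
    · simp [add_mul]
  mul_assoc x y z := by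
    ext
    · simp [mul_assoc]
    · simp only [mul_off, mul_base, mul_pt, smul_add, mul_smul, smul_comm z.pt x.base,
        smul_comm z.pt y.pt x.off, add_assoc]
    · simp [mul_assoc]

instance : Algebra k (OnePointExtension k B M) where
  algebraMap :=
    { toFun := fun c => ⟨algebraMap k B c, 0, c⟩
      map_one' := by ext <;> simp
      map_mul' := fun c d => by ext <;> simp
      map_zero' := by ext <;> simp
      map_add' := fun c d => by ext <;> simp }
  commutes' c x := by
    ext
    · simp [Algebra.commutes]
    · simp
    · simp [mul_comm]
  smul_def' c x := by
    ext
    · simp [Algebra.smul_def]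
    · simp
    · simp

end Algebra

section Triple

variable {k B M : Type u} [Field k] [Ring B] [Algebra k B] [AddCommGroup M] [Module k M]
  [Module B M] [IsScalarTower k B M]
  {V X : Type u} [AddCommGroup V] [Module k V] [AddCommGroup X] [Module B X]

/-- The left `B[M]`-module `(V, X, f)` given by a `k`-vector space `V`, a left `B`-module `X` and a
`B`-linear map `f : M ⊗ₖ V → X`. Its elements are the pairs of a `v ∈ V` and an `x ∈ X`. -/
@[ext]
structure Triple (f : M ⊗[k] V →ₗ[B] X) : Type u where
  vec : V
  elt : X

namespace Triple

variable (f : M ⊗[k] V →ₗ[B] X)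

instance : Zero (Triple f) := ⟨⟨0, 0⟩⟩
instance : Add (Triple f) := ⟨fun z w => ⟨z.vec + w.vec, z.elt + w.elt⟩⟩
instance : Neg (Triple f) := ⟨fun z => ⟨-z.vec, -z.elt⟩⟩

/-- A matrix acts on `(v, x)`, viewed as the column with upper entry `x` and lower entry `v`, by
the usual rule, an element `a` of `M` taking `v` to `f (a ⊗ v)`. -/
instance : SMul (OnePointExtension k B M) (Triple f) :=
  ⟨fun r z => ⟨r.pt • z.vec, r.base • z.elt + f (r.off ⊗ₜ z.vec)⟩⟩

@[simp] theorem zero_vec : (0 : Triple f).vec = 0 := rfl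
@[simp] theorem zero_elt : (0 : Triple f).elt = 0 := rfl
@[simp] theorem add_vec (z w : Triple f) : (z + w).vec = z.vec + w.vec := rfl
@[simp] theorem add_elt (z w : Triple f) : (z + w).elt = z.elt + w.elt := rfl
@[simp] theorem neg_vec (z : Triple f) : (-z).vec = -z.vec := rfl
@[simp] theorem neg_elt (z : Triple f) : (-z).elt = -z.elt := rfl
@[simp] theorem smul_vec (r : OnePointExtension k B M) (z : Triple f) :
    (r • z).vec = r.pt • z.vec := rfl
@[simp] theorem smul_elt (r : OnePointExtension k B M) (z : Triple f) :
    (r • z).elt = r.base • z.elt + f (r.off ⊗ₜ z.vec) := rfl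

instance : AddCommGroup (Triple f) where
  add_assoc x y z := by ext <;> simp [add_assoc]
  zero_add x := by ext <;> simp
  add_zero x := by ext <;> simp
  add_comm x y := by ext <;> simp [add_comm]
  neg_add_cancel x := by ext <;> simp
  nsmul := nsmulRec
  zsmul := zsmulRec

instance : Module (OnePointExtension k B M) (Triple f) where
  one_smul z := by ext <;> simp
  mul_smul r s z := by
    ext
    · simp [mul_smul]
    · simp only [smul_elt, smul_vec, mul_off, mul_base, smul_add, mul_smul, add_tmul, map_add,
        ← f.map_smul, smul_tmul', tmul_smul, add_assoc]
  smul_zero r := by ext <;> simp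
  smul_add r z w := by
    ext
    · simp
    · simp only [smul_elt, add_elt, add_vec, smul_add, tmul_add, map_add]
      abel
  add_smul r s z := by
    ext
    · simp [add_smul]
    · simp only [smul_elt, add_elt, add_base, add_off, add_smul, add_tmul, map_add]
      abel
  zero_smul z := by ext <;> simp

end Triple

end Triple

end OnePointExtension

/-!
Write `A = B[M]`. Every `A`-module `Y` is, by its Peirce decomposition, a triple `(V, X, f)`
(`equivTriple`), and it sits in an exact sequence `0 → (0, X, 0) → (V, X, f) → (V, 0, 0) → 0`. Three
facts make `Ext` over `A` in degrees at least two a matter of the `B`-modules `X` alone.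

* Restriction of scalars along the surjection `A → B`, that is `X ↦ (0, X, 0)`, is exact and fully
  faithful, and it preserves projectives because `B` is a direct summand of `A` as a left
  `A`-module. So it induces isomorphisms on `Ext`
  (`ModuleCat.subsingleton_ext_restrictScalars_iff`).
* `(V, 0, 0)` is an injective `A`-module (`injective_ofPt`).
* `(V, 0, 0)` has projective dimension at most one (`hasProjectiveDimensionLT_ofPt`). This uses that
  `M` is projective: the kernel of `A → k` is `(0, B × M, 0)`.

Hence, for `i ≥ 2`, the vanishing of `Ext^i_B(U, X)` implies that of `Ext^i_A((W, U, g), (V, X, f))`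
(`subsingleton_ext_triple`). Letting one of the two arguments run through all modules gives
`pd_A (V, X, f) ≤ max(pd_B X, 1)` and `id_A (V, X, f) ≤ max(id_B X, 1)`, and
`pd_B X ≤ pd_A (0, X, 0)` holds by the first fact. The global dimension of `A` is therefore that
of `B`, and the bound assumed for `X` passes to every finitely generated indecomposable
`(V, X, f)`.
-/

/-! ### Change of rings along a surjection -/

theorem Module.Projective.finsupp (R P ι : Type*) [Ring R] [AddCommGroup P] [Module R P]
    [Module.Projective R P] : Module.Projective R (ι →₀ P) := by
  classical
  exact Module.Projective.of_equiv (finsuppLequivDFinsupp (M := P) (ι := ι) R).symm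

/-- Projectivity is transitive along a change of rings: if `S` is projective over `R` and `P` is
projective over `S`, then `P` is projective over `R`. -/
theorem Module.Projective.of_isScalarTower (R S P : Type*) [Ring R] [Ring S] [AddCommGroup P]
    [Module R S] [Module S P] [Module R P] [IsScalarTower R S S] [IsScalarTower R S P]
    [Module.Projective R S] [Module.Projective S P] : Module.Projective R P := by
  obtain ⟨s, hs⟩ := Module.projective_def'.1 ‹Module.Projective S P›
  have := Module.Projective.finsupp R S P
  refine Module.Projective.of_split (s.restrictScalars R)
    ((Finsupp.linearCombination S id).restrictScalars R) ?_
  ext p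
  exact LinearMap.congr_fun hs p

namespace ModuleCat

variable {R S : Type u} [Ring R] [Ring S] (φ : R →+* S)

theorem full_restrictScalars (hφ : Function.Surjective φ) :
    (restrictScalars.{u} φ).Full where
  map_surjective {X Y} g := by
    refine ⟨ofHom { toFun := fun x => g.hom x, map_add' := fun x y => g.hom.map_add x y,
                    map_smul' := fun s x => ?_ }, rfl⟩
    obtain ⟨r, rfl⟩ := hφ s
    exact g.hom.map_smul r x

theorem preservesProjectiveObjects_restrictScalars
    (h : Module.Projective R ((restrictScalars φ).obj (of S S))) :
    (restrictScalars.{u} φ).PreservesProjectiveObjects where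
  projective_obj {X} hX := by
    let : Module R S := Module.compHom S φ
    let : Module R X := Module.compHom X φ
    have : IsScalarTower R S S := ⟨fun r s t => mul_assoc (φ r) s t⟩
    have : IsScalarTower R S X := ⟨fun r s t => mul_smul (φ r) s t⟩
    have : Module.Projective R S := h
    have : Module.Projective S X := (IsProjective.iff_projective X).2 hX
    exact (IsProjective.iff_projective X).1 (Module.Projective.of_isScalarTower R S X)

/-- Restriction along a surjective ring homomorphism `R → S` with `S` projective over `R` is an
exact and fully faithful functor preserving projectives, hence it induces isomorphisms on `Ext`. -/
theorem subsingleton_ext_restrictScalars_iff (hφ : Function.Surjective φ)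
    (h : Module.Projective R ((restrictScalars φ).obj (of S S))) (X Y : ModuleCat.{u} S) (n : ℕ) :
    Subsingleton (Abelian.Ext.{u} ((restrictScalars φ).obj X) ((restrictScalars φ).obj Y) n) ↔
      Subsingleton (Abelian.Ext.{u} X Y n) := by
  have := full_restrictScalars φ hφ
  have hex := ((Functor.exact_tfae (restrictScalars.{u} φ)).out 1 3).mp fun S hS => by
    rw [ShortComplex.ShortExact.moduleCat_exact_iff_function_exact] at hS ⊢
    exact hS
  have := hex.1
  have := hex.2
  have := preservesProjectiveObjects_restrictScalars φ h
  exact (Equiv.ofBijective _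
    (Functor.mapExt_bijective_of_preservesProjectiveObjects
      (restrictScalars φ) X Y n)).subsingleton_congr.symm

theorem projectiveDimension_le_restrictScalars (hφ : Function.Surjective φ)
    (h : Module.Projective R ((restrictScalars φ).obj (of S S))) (X : ModuleCat.{u} S) :
    projectiveDimension X ≤ projectiveDimension ((restrictScalars φ).obj X) := by
  refine sInf_le_sInf fun n hn i hi => ?_
  have := hn i hi
  refine HasProjectiveDimensionLT.mk fun j hj Y e => ?_
  have := (subsingleton_ext_restrictScalars_iff φ hφ h X Y j).1
    (HasProjectiveDimensionLT.subsingleton _ i j hj _)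
  exact Subsingleton.elim _ _

end ModuleCat

/-! ### Modules concentrated at `B` or at `k` -/

namespace OnePointExtension

variable {k B M : Type u} [Field k] [Ring B] [Algebra k B] [AddCommGroup M] [Module k M]
  [Module B M] [IsScalarTower k B M]

variable (k B M) in
/-- The projection of `B[M]` onto `B`. -/
def baseHom : OnePointExtension k B M →+* B where
  toFun := base
  map_one' := rfl
  map_mul' _ _ := rfl
  map_zero' := rfl
  map_add' _ _ := rfl

variable (k B M) in
/-- The projection of `B[M]` onto `k`. -/
def ptHom : OnePointExtension k B M →+* k where
  toFun := pt
  map_one' := rfl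
  map_mul' _ _ := rfl
  map_zero' := rfl
  map_add' _ _ := rfl

theorem baseHom_surjective : Function.Surjective (baseHom k B M) := fun b => ⟨⟨b, 0, 0⟩, rfl⟩

variable (k M) in
/-- The functor turning a `B`-module `X` into the `B[M]`-module `(0, X, 0)`. -/
noncomputable abbrev ofBase : ModuleCat.{u} B ⥤ ModuleCat.{u} (OnePointExtension k B M) :=
  ModuleCat.restrictScalars (baseHom k B M)

variable (B M) in
/-- The functor turning a `k`-vector space `V` into the `B[M]`-module `(V, 0, 0)`. -/
noncomputable abbrev ofPt : ModuleCat.{u} k ⥤ ModuleCat.{u} (OnePointExtension k B M) :=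
  ModuleCat.restrictScalars (ptHom k B M)

/-- The left ideal of matrices supported in the first column is a direct summand of `B[M]`
isomorphic to `B`. -/
theorem projective_ofBase_self :
    Module.Projective (OnePointExtension k B M) ((ofBase k M).obj (ModuleCat.of B B)) := by
  let i : (ofBase k M).obj (ModuleCat.of B B) →ₗ[OnePointExtension k B M]
      OnePointExtension k B M :=
    { toFun := fun b => (⟨b, 0, 0⟩ : OnePointExtension k B M)
      map_add' := fun x y => OnePointExtension.ext rfl (add_zero 0).symm (add_zero 0).symm
      map_smul' := fun r x => by
        refine OnePointExtension.ext rfl ?_ (mul_zero r.pt).symm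
        change 0 = r.base • (0 : M) + (0 : k) • r.off
        rw [smul_zero, zero_smul, add_zero] }
  let p : OnePointExtension k B M →ₗ[OnePointExtension k B M]
      (ofBase k M).obj (ModuleCat.of B B) :=
    { toFun := base
      map_add' := fun x y => rfl
      map_smul' := fun r x => rfl }
  exact Module.Projective.of_split i p (LinearMap.ext fun _ => rfl)

/-- A `k`-linear extension of a `B[M]`-linear map into `(V, 0, 0)` can be corrected to a
`B[M]`-linear one by the idempotent of `k`. -/
theorem injective_ofPt (V : ModuleCat.{u} k) : Injective ((ofPt B M).obj V) := by
  let : Module (OnePointExtension k B M) V := Module.compHom V (ptHom k B M)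
  have hV : ∀ (r : OnePointExtension k B M) (v : V), r • v = r.pt • v := fun _ _ => rfl
  suffices Module.Injective (OnePointExtension k B M) V from
    Module.injective_object_of_injective_module (inj := this)
  refine Module.Baer.injective fun I g => ?_
  have : IsScalarTower k (OnePointExtension k B M) V := ⟨fun c r v => by
    rw [hV, smul_pt, mul_smul, hV]⟩
  obtain ⟨h, hh⟩ := (g.restrictScalars k).exists_extend (p := I.restrictScalars k)
  refine ⟨{ toFun := fun a => h (⟨0, 0, 1⟩ * a)
            map_add' := fun a b => by rw [mul_add, map_add]
            map_smul' := fun r a => ?_ }, fun a ha => ?_⟩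
  · have : (⟨0, 0, 1⟩ * (r • a) : OnePointExtension k B M) =
        r.pt • (⟨0, 0, 1⟩ * a : OnePointExtension k B M) := by
      ext <;> simp [mul_comm]
    rw [this, map_smul, RingHom.id_apply, hV]
  · have h1 := LinearMap.congr_fun hh ⟨_, I.mul_mem_left ⟨0, 0, 1⟩ ha⟩
    have h2 := g.map_smul (⟨0, 0, 1⟩ : OnePointExtension k B M) ⟨a, ha⟩
    rw [hV, one_smul] at h2
    exact h1.trans h2

section Projective

variable [Module.Projective B M]

/-- `(V, 0, 0)` is the quotient of a free `B[M]`-module by a module of the form `(0, P, 0)` with `P`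
projective. -/
theorem hasProjectiveDimensionLT_ofPt (V : ModuleCat.{u} k) :
    HasProjectiveDimensionLT ((ofPt B M).obj V) 2 := by
  let ι := Module.Free.ChooseBasisIndex k V
  let e : V ≅ ModuleCat.of k (ι →₀ k) := (Module.Free.chooseBasis k V).repr.toModuleIso
  suffices HasProjectiveDimensionLT ((ofPt B M).obj (ModuleCat.of k (ι →₀ k))) 2 from
    hasProjectiveDimensionLT_of_iso ((ofPt B M).mapIso e.symm) 2
  -- the kernel of `B[M] → k` is `(0, B × M, 0)`, and `B × M` is projective over `B`
  let i : (ofBase k M).obj (ModuleCat.of B (ι →₀ B × M)) →ₗ[OnePointExtension k B M]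
      (ι →₀ OnePointExtension k B M) :=
    { toFun := fun x => Finsupp.mapRange
        (fun y : B × M => (⟨y.1, y.2, 0⟩ : OnePointExtension k B M)) rfl x
      map_add' := fun x y => by
        refine Finsupp.mapRange_add (fun x y => ?_) x y
        exact OnePointExtension.ext rfl rfl (add_zero 0).symm
      map_smul' := fun r x => by
        refine Finsupp.ext fun j => OnePointExtension.ext rfl ?_ (mul_zero r.pt).symm
        change _ = r.base • (DFunLike.coe (F := ι →₀ B × M) x j).2 + (0 : k) • r.off
        rw [zero_smul, add_zero]
        rfl }
  let p : (ι →₀ OnePointExtension k B M) →ₗ[OnePointExtension k B M]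
      (ofPt B M).obj (ModuleCat.of k (ι →₀ k)) :=
    { toFun := fun x => Finsupp.mapRange (fun a : OnePointExtension k B M => a.pt) rfl x
      map_add' := fun x y => Finsupp.mapRange_add (fun _ _ => rfl) x y
      map_smul' := fun r x => Finsupp.ext fun _ => rfl }
  have hip : Function.Exact i p := by
    intro x
    constructor
    · intro hx
      refine ⟨Finsupp.mapRange (fun a : OnePointExtension k B M => (a.base, a.off)) rfl x,
        Finsupp.ext fun j => ?_⟩
      have : (x j).pt = 0 := DFunLike.congr_fun
        (show Finsupp.mapRange (fun a : OnePointExtension k B M => a.pt) rfl x = 0 from hx) j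
      ext
      · rfl
      · rfl
      · exact this.symm
    · rintro ⟨y, rfl⟩
      exact Finsupp.ext fun j => rfl
  have hi : Function.Injective i := fun x y hxy => Finsupp.ext fun j => by
    have := DFunLike.congr_fun hxy j
    exact Prod.ext (congrArg base this) (congrArg off this)
  have hp : Function.Surjective p := fun x =>
    ⟨Finsupp.mapRange (fun c => (⟨0, 0, c⟩ : OnePointExtension k B M)) rfl x,
      Finsupp.ext fun _ => rfl⟩
  let S := ShortComplex.mk (ModuleCat.ofHom i) (ModuleCat.ofHom p)
    (ModuleCat.hom_ext hip.linearMap_comp_eq_zero)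
  have hS : S.ShortExact := ModuleCat.shortComplex_shortExact S hip hi hp
  have := ModuleCat.preservesProjectiveObjects_restrictScalars (baseHom k B M)
    projective_ofBase_self
  have : Projective (ModuleCat.of B (ι →₀ B × M)) :=
    (IsProjective.iff_projective _).1 (Module.Projective.finsupp B (B × M) ι)
  have : Projective S.X₁ := (ofBase k M).projective_obj (ModuleCat.of B (ι →₀ B × M))
  have : Projective S.X₂ :=
    (IsProjective.iff_projective (ι →₀ OnePointExtension k B M)).1 inferInstance
  exact hS.hasProjectiveDimensionLT_X₃ 1 inferInstance inferInstance

end Projective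

/-! ### Peirce decomposition -/

section Decomposition

variable (k B M) in
/-- The `B`-module `X` of a `B[M]`-module `Y ≃ (V, X, f)`: the part of `Y` killed by the
idempotent of `k`. -/
def basePart (Y : Type u) [AddCommGroup Y] [Module (OnePointExtension k B M) Y] :
    AddSubgroup Y :=
  (DistribSMul.toAddMonoidHom Y (⟨0, 0, 1⟩ : OnePointExtension k B M)).ker

variable (k B M) in
/-- The vector space `V` of a `B[M]`-module `Y ≃ (V, X, f)`: the part of `Y` killed by the
idempotent of `B`. -/
def ptPart (Y : Type u) [AddCommGroup Y] [Module (OnePointExtension k B M) Y] :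
    AddSubgroup Y :=
  (DistribSMul.toAddMonoidHom Y (⟨1, 0, 0⟩ : OnePointExtension k B M)).ker

variable {Y : Type u} [AddCommGroup Y] [Module (OnePointExtension k B M) Y]

theorem mem_basePart {y : Y} :
    y ∈ basePart k B M Y ↔ (⟨0, 0, 1⟩ : OnePointExtension k B M) • y = 0 := Iff.rfl

theorem mem_ptPart {y : Y} :
    y ∈ ptPart k B M Y ↔ (⟨1, 0, 0⟩ : OnePointExtension k B M) • y = 0 := Iff.rfl

theorem smul_mem_basePart (b : B) (a : M) (y : Y) :
    (⟨b, a, 0⟩ : OnePointExtension k B M) • y ∈ basePart k B M Y := by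
  have : (⟨0, 0, 1⟩ * ⟨b, a, 0⟩ : OnePointExtension k B M) = 0 := by ext <;> simp
  rw [mem_basePart, smul_smul, this, zero_smul]

theorem smul_mem_ptPart (c : k) (y : Y) :
    (⟨0, 0, c⟩ : OnePointExtension k B M) • y ∈ ptPart k B M Y := by
  have : (⟨1, 0, 0⟩ * ⟨0, 0, c⟩ : OnePointExtension k B M) = 0 := by ext <;> simp
  rw [mem_ptPart, smul_smul, this, zero_smul]

theorem idempotent_smul_add (y : Y) : (⟨0, 0, 1⟩ : OnePointExtension k B M) • y +
    (⟨1, 0, 0⟩ : OnePointExtension k B M) • y = y := by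
  have : (⟨0, 0, 1⟩ + ⟨1, 0, 0⟩ : OnePointExtension k B M) = 1 := by ext <;> simp
  rw [← add_smul, this, one_smul]

instance : Module B (basePart k B M Y) where
  smul b x := ⟨(⟨b, 0, 0⟩ : OnePointExtension k B M) • x.1, smul_mem_basePart b 0 x.1⟩
  one_smul x := Subtype.ext <| by
    have h := idempotent_smul_add (k := k) (B := B) (M := M) x.1
    rwa [mem_basePart.1 x.2, zero_add] at h
  mul_smul b c x := Subtype.ext <| by
    have : (⟨b * c, 0, 0⟩ : OnePointExtension k B M) = ⟨b, 0, 0⟩ * ⟨c, 0, 0⟩ := by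
      ext <;> simp
    exact (congrArg (· • x.1) this).trans (mul_smul _ _ _)
  smul_zero b := Subtype.ext <| smul_zero _
  smul_add b x y := Subtype.ext <| smul_add _ _ _
  add_smul b c x := Subtype.ext <| by
    have : (⟨b + c, 0, 0⟩ : OnePointExtension k B M) = ⟨b, 0, 0⟩ + ⟨c, 0, 0⟩ := by
      ext <;> simp
    exact (congrArg (· • x.1) this).trans (add_smul _ _ _)
  zero_smul x := Subtype.ext <| zero_smul (OnePointExtension k B M) x.1

instance : Module k (ptPart k B M Y) where
  smul c v := ⟨(⟨0, 0, c⟩ : OnePointExtension k B M) • v.1, smul_mem_ptPart c v.1⟩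
  one_smul v := Subtype.ext <| by
    have h := idempotent_smul_add (k := k) (B := B) (M := M) v.1
    rwa [mem_ptPart.1 v.2, add_zero] at h
  mul_smul b c v := Subtype.ext <| by
    have : (⟨0, 0, b * c⟩ : OnePointExtension k B M) = ⟨0, 0, b⟩ * ⟨0, 0, c⟩ := by
      ext <;> simp
    exact (congrArg (· • v.1) this).trans (mul_smul _ _ _)
  smul_zero c := Subtype.ext <| smul_zero _
  smul_add c v w := Subtype.ext <| smul_add _ _ _
  add_smul b c v := Subtype.ext <| by
    have : (⟨0, 0, b + c⟩ : OnePointExtension k B M) = ⟨0, 0, b⟩ + ⟨0, 0, c⟩ := by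
      ext <;> simp
    exact (congrArg (· • v.1) this).trans (add_smul _ _ _)
  zero_smul v := Subtype.ext <| zero_smul (OnePointExtension k B M) v.1

variable (k B M Y) in
/-- The additive map underlying `structureMap`. -/
noncomputable def structureAddHom : M ⊗[k] ptPart k B M Y →+ basePart k B M Y :=
  TensorProduct.liftAddHom
    (AddMonoidHom.mk' (fun a => AddMonoidHom.mk'
        (fun v => ⟨(⟨0, a, 0⟩ : OnePointExtension k B M) • v.1, smul_mem_basePart 0 a v.1⟩)
        fun _ _ => Subtype.ext <| smul_add _ _ _)
      fun a b => AddMonoidHom.ext fun v => Subtype.ext <| by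
        have : (⟨0, a + b, 0⟩ : OnePointExtension k B M) = ⟨0, a, 0⟩ + ⟨0, b, 0⟩ := by
          ext <;> simp
        exact (congrArg (· • v.1) this).trans (add_smul _ _ _))
    fun c a v => Subtype.ext <| by
      have : (⟨0, c • a, 0⟩ : OnePointExtension k B M) = ⟨0, a, 0⟩ * ⟨0, 0, c⟩ := by
        ext <;> simp
      exact (congrArg (· • v.1) this).trans (mul_smul _ _ _)

variable (k B M Y) in
/-- The `B`-linear map `f` of a `B[M]`-module `Y ≃ (V, X, f)`, given by the action of `M`. -/
noncomputable def structureMap : M ⊗[k] ptPart k B M Y →ₗ[B] basePart k B M Y where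
  toFun := structureAddHom k B M Y
  map_add' := map_add _
  map_smul' b z := by
    induction z using TensorProduct.induction_on with
    | zero => simp
    | add z w hz hw => rw [smul_add, map_add, hz, hw, map_add, smul_add]
    | tmul a v =>
      refine Subtype.ext ?_
      have : (⟨0, b • a, 0⟩ : OnePointExtension k B M) = ⟨b, 0, 0⟩ * ⟨0, a, 0⟩ := by
        ext <;> simp
      exact (congrArg (· • v.1) this).trans (mul_smul _ _ _)

variable (k B M Y) in
/-- The Peirce decomposition of a `B[M]`-module. -/
noncomputable def equivTriple :
    Y ≃ₗ[OnePointExtension k B M] Triple (structureMap k B M Y) where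
  toFun y := ⟨⟨_, smul_mem_ptPart 1 y⟩, ⟨_, smul_mem_basePart 1 0 y⟩⟩
  invFun z := z.vec + z.elt
  map_add' y z := Triple.ext (Subtype.ext <| smul_add _ _ _) (Subtype.ext <| smul_add _ _ _)
  map_smul' r y := by
    refine Triple.ext (Subtype.ext ?_) (Subtype.ext ?_)
    · change (⟨0, 0, 1⟩ : OnePointExtension k B M) • r • y =
        (⟨0, 0, r.pt⟩ : OnePointExtension k B M) • (⟨0, 0, 1⟩ : OnePointExtension k B M) • y
      rw [smul_smul, smul_smul]
      congr 1
      ext <;> simp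
    · change (⟨1, 0, 0⟩ : OnePointExtension k B M) • r • y =
        (⟨r.base, 0, 0⟩ : OnePointExtension k B M) • (⟨1, 0, 0⟩ : OnePointExtension k B M) • y +
        (⟨0, r.off, 0⟩ : OnePointExtension k B M) • (⟨0, 0, 1⟩ : OnePointExtension k B M) • y
      rw [smul_smul, smul_smul, smul_smul, ← add_smul]
      congr 1
      ext <;> simp
  left_inv y := idempotent_smul_add y
  right_inv z := by
    have h₁ := idempotent_smul_add (k := k) (B := B) (M := M) z.vec.1
    have h₂ := idempotent_smul_add (k := k) (B := B) (M := M) z.elt.1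
    rw [mem_ptPart.1 z.vec.2, add_zero] at h₁
    rw [mem_basePart.1 z.elt.2, zero_add] at h₂
    refine Triple.ext (Subtype.ext ?_) (Subtype.ext ?_)
    · change (⟨0, 0, 1⟩ : OnePointExtension k B M) • (z.vec.1 + z.elt.1) = _
      rw [smul_add, h₁, mem_basePart.1 z.elt.2, add_zero]
    · change (⟨1, 0, 0⟩ : OnePointExtension k B M) • (z.vec.1 + z.elt.1) = _
      rw [smul_add, h₂, mem_ptPart.1 z.vec.2, zero_add]

end Decomposition

/-! ### The exact sequence of a triple -/

namespace Triple

variable {V X : Type u} [AddCommGroup V] [Module k V] [AddCommGroup X] [Module B X]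
  (f : M ⊗[k] V →ₗ[B] X)

/-- Replacing the vector space `V` of a triple by an isomorphic one. -/
noncomputable def congrVec {W : Type u} [AddCommGroup W] [Module k W] (e : W ≃ₗ[k] V) :
    Triple (f ∘ₗ AlgebraTensorModule.lTensor B M e.toLinearMap) ≃ₗ[OnePointExtension k B M]
      Triple f where
  toFun z := ⟨e z.vec, z.elt⟩
  invFun z := ⟨e.symm z.vec, z.elt⟩
  map_add' _ _ := Triple.ext (map_add e _ _) rfl
  map_smul' _ _ := Triple.ext (map_smul e _ _) rfl
  left_inv _ := Triple.ext (e.symm_apply_apply _) rfl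
  right_inv _ := Triple.ext (e.apply_symm_apply _) rfl

/-- The inclusion of `(0, X, 0)` into `(V, X, f)`. -/
def inl : (ofBase k M).obj (ModuleCat.of B X) →ₗ[OnePointExtension k B M] Triple f where
  toFun x := ⟨0, x⟩
  map_add' _ _ := Triple.ext (add_zero 0).symm rfl
  map_smul' r x := by
    refine Triple.ext (smul_zero r.pt).symm ?_
    rw [RingHom.id_apply, smul_elt, tmul_zero, map_zero, add_zero]
    rfl

/-- The projection of `(V, X, f)` onto `(V, 0, 0)`. -/
def toVec : Triple f →ₗ[OnePointExtension k B M] (ofPt B M).obj (ModuleCat.of k V) where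
  toFun z := z.vec
  map_add' _ _ := rfl
  map_smul' _ _ := rfl

theorem exact_inl_toVec : Function.Exact (inl f) (toVec f) := fun z =>
  ⟨fun h => ⟨z.elt, Triple.ext h.symm rfl⟩, by rintro ⟨x, rfl⟩; rfl⟩

theorem inl_injective : Function.Injective (inl f) := fun _ _ h => congrArg elt h

theorem toVec_surjective : Function.Surjective (toVec f) := fun v => ⟨⟨v, 0⟩, rfl⟩

/-- The complex `(0, X, 0) → (V, X, f) → (V, 0, 0)`. -/
noncomputable abbrev shortComplex : ShortComplex (ModuleCat.{u} (OnePointExtension k B M)) :=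
  .mk (ModuleCat.ofHom (inl f)) (ModuleCat.ofHom (toVec f))
    (ModuleCat.hom_ext (exact_inl_toVec f).linearMap_comp_eq_zero)

theorem shortExact_shortComplex : (shortComplex f).ShortExact :=
  ModuleCat.shortComplex_shortExact _ (exact_inl_toVec f) (inl_injective f) (toVec_surjective f)

theorem finite_elt [IsNoetherianRing (OnePointExtension k B M)]
    (f : M ⊗[k] V →ₗ[B] X)
    [Module.Finite (OnePointExtension k B M) (Triple f)] : Module.Finite B X := by
  have := Module.Finite.of_injective (inl f) (inl_injective f)
  let g : (ofBase k M).obj (ModuleCat.of B X) →ₛₗ[baseHom k B M] X :=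
    { toFun := fun x => x
      map_add' := fun _ _ => rfl
      map_smul' := fun _ _ => rfl }
  have : RingHomSurjective (baseHom k B M) := ⟨baseHom_surjective⟩
  exact Module.Finite.of_surjective g fun x => ⟨x, rfl⟩

theorem finite_vec (f : M ⊗[k] V →ₗ[B] X)
    [Module.Finite (OnePointExtension k B M) (Triple f)] : Module.Finite k V := by
  let g : Triple f →ₛₗ[ptHom k B M] V :=
    { toFun := vec
      map_add' := fun _ _ => rfl
      map_smul' := fun _ _ => rfl }
  have : RingHomSurjective (ptHom k B M) := ⟨fun c => ⟨⟨0, 0, c⟩, rfl⟩⟩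
  exact Module.Finite.of_surjective g fun v => ⟨⟨v, 0⟩, rfl⟩

end Triple

/-! ### Homological dimensions -/

section Dimension

variable [Module.Projective B M]

/-- In degrees at least two, `Ext` over `B[M]` only sees the underlying `B`-modules: there
`(W, 0, 0)` has no `Ext` out of it and `(V, 0, 0)` none into it. -/
theorem subsingleton_ext_triple {V X W U : Type u} [AddCommGroup V] [Module k V]
    [AddCommGroup X] [Module B X] [AddCommGroup W] [Module k W] [AddCommGroup U] [Module B U]
    (g : M ⊗[k] W →ₗ[B] U) (f : M ⊗[k] V →ₗ[B] X) (n : ℕ) (hn : 2 ≤ n)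
    (h : Subsingleton (Abelian.Ext.{u} (ModuleCat.of B U) (ModuleCat.of B X) n)) :
    Subsingleton (Abelian.Ext.{u} (ModuleCat.of (OnePointExtension k B M) (Triple g))
      (ModuleCat.of (OnePointExtension k B M) (Triple f)) n) := by
  rw [← ModuleCat.subsingleton_ext_restrictScalars_iff (baseHom k B M) baseHom_surjective
    projective_ofBase_self] at h
  have := injective_ofPt (B := B) (M := M) (ModuleCat.of k V)
  have := hasProjectiveDimensionLT_ofPt (B := B) (M := M) (ModuleCat.of k W)
  refine subsingleton_of_forall_eq 0 fun e => ?_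
  have hres : (Abelian.Ext.mk₀ (Triple.shortComplex g).f).comp e (zero_add n) = 0 := by
    obtain ⟨x, hx⟩ := Abelian.Ext.covariant_sequence_exact₂ _ (Triple.shortExact_shortComplex f)
      ((Abelian.Ext.mk₀ (Triple.shortComplex g).f).comp e (zero_add n))
      (Abelian.Ext.eq_zero_of_hasInjectiveDimensionLT _ 1 (by lia))
    rw [← hx, Subsingleton.elim x 0, Abelian.Ext.zero_comp]
  obtain ⟨y, hy⟩ := Abelian.Ext.contravariant_sequence_exact₂ (Triple.shortExact_shortComplex g)
    _ e hres
  rw [← hy, Abelian.Ext.eq_zero_of_hasProjectiveDimensionLT y 2 hn, Abelian.Ext.comp_zero]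

theorem hasProjectiveDimensionLE_triple {V X : Type u} [AddCommGroup V] [Module k V]
    [AddCommGroup X] [Module B X] (f : M ⊗[k] V →ₗ[B] X) (n : ℕ) (hn : 1 ≤ n)
    [HasProjectiveDimensionLE (ModuleCat.of B X) n] :
    HasProjectiveDimensionLE (ModuleCat.of (OnePointExtension k B M) (Triple f)) n := by
  refine HasProjectiveDimensionLT.mk fun i hi Y e => ?_
  let ε := (equivTriple k B M Y).toModuleIso
  have := subsingleton_ext_triple f (structureMap k B M Y) i (by lia)
    (HasProjectiveDimensionLT.subsingleton _ (n + 1) i hi _)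
  rw [← e.comp_mk₀_id, ← ε.hom_inv_id, ← Abelian.Ext.mk₀_comp_mk₀,
    ← Abelian.Ext.comp_assoc_of_second_deg_zero,
    Subsingleton.elim (e.comp (Abelian.Ext.mk₀ ε.hom) (add_zero i)) 0, Abelian.Ext.zero_comp]

theorem hasInjectiveDimensionLE_triple {V X : Type u} [AddCommGroup V] [Module k V]
    [AddCommGroup X] [Module B X] (f : M ⊗[k] V →ₗ[B] X) (n : ℕ) (hn : 1 ≤ n)
    [HasInjectiveDimensionLE (ModuleCat.of B X) n] :
    HasInjectiveDimensionLE (ModuleCat.of (OnePointExtension k B M) (Triple f)) n := by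
  refine HasInjectiveDimensionLT.mk fun i hi Y e => ?_
  let ε := (equivTriple k B M Y).toModuleIso
  have := subsingleton_ext_triple (structureMap k B M Y) f i (by lia)
    (HasInjectiveDimensionLT.subsingleton _ (n + 1) i hi _)
  rw [← e.mk₀_id_comp, ← ε.hom_inv_id, ← Abelian.Ext.mk₀_comp_mk₀,
    Abelian.Ext.comp_assoc_of_second_deg_zero,
    Subsingleton.elim ((Abelian.Ext.mk₀ ε.inv).comp e (zero_add i)) 0, Abelian.Ext.comp_zero]

theorem globalDimension_eq (n : ℕ) (hn : 1 ≤ n) (h : globalDimension B = n) :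
    globalDimension (OnePointExtension k B M) = n := by
  refine le_antisymm (iSup_le fun Y => ?_) (h ▸ iSup_le fun X => ?_)
  · have : HasProjectiveDimensionLE (ModuleCat.of B (basePart k B M Y)) n :=
      (projectiveDimension_le_iff _ n).1
        ((le_iSup (fun X : ModuleCat.{u} B => projectiveDimension X) _).trans h.le)
    have := hasProjectiveDimensionLE_triple (structureMap k B M Y) n hn
    exact (projectiveDimension_le_iff Y n).2
      (hasProjectiveDimensionLT_of_iso (equivTriple k B M Y).symm.toModuleIso (n + 1))
  · exact (ModuleCat.projectiveDimension_le_restrictScalars (baseHom k B M) baseHom_surjective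
      projective_ofBase_self X).trans (le_iSup (fun Y : ModuleCat.{u} (OnePointExtension k B M) =>
        projectiveDimension Y) _)

end Dimension

/-! ### Almost hereditary one-point extensions -/

theorem finite [Module.Finite k B] [Module.Finite B M] :
    Module.Finite k (OnePointExtension k B M) := by
  have := Module.Finite.trans (R := k) B M
  let g : (B × M × k) →ₗ[k] OnePointExtension k B M :=
    { toFun := fun x => ⟨x.1, x.2.1, x.2.2⟩
      map_add' := fun _ _ => rfl
      map_smul' := fun _ _ => rfl }
  exact Module.Finite.of_surjective g fun x => ⟨(x.base, x.off, x.pt), rfl⟩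

end OnePointExtension

theorem CategoryTheory.Indecomposable.of_iso {C : Type*} [Category C]
    [Limits.HasZeroMorphisms C] [Limits.HasBinaryBiproducts C] {X Y : C} (e : X ≅ Y)
    (h : Indecomposable X) : Indecomposable Y :=
  ⟨fun hY => h.1 (hY.of_iso e), fun Z W i => h.2 Z W (e ≪≫ i)⟩

theorem mainTheorem8 (k B M : Type u) [Field k] [Ring B] [Algebra k B]
    [AddCommGroup M] [Module k M] [Module B M] [IsScalarTower k B M]
    [Module.Finite B M] [Module.Projective B M]
    (m : ℕ) (hm : 0 < m) (hB : IsAlmostHereditary k B m 1)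
    (h : ∀ (t : ℕ) (X : Type u) [AddCommGroup X] [Module B X] [Module.Finite B X]
      (f : M ⊗[k] (Fin t → k) →ₗ[B] X),
      Indecomposable (ModuleCat.of (OnePointExtension k B M) (OnePointExtension.Triple f)) →
        projectiveDimension (ModuleCat.of B X) ≤ m ∨
          injectiveDimension (ModuleCat.of B X) ≤ 1) :
    IsAlmostHereditary k (OnePointExtension k B M) m 1 := by
  have := hB.finite
  have hfin : Module.Finite k (OnePointExtension k B M) := OnePointExtension.finite
  refine ⟨hfin, OnePointExtension.globalDimension_eq (m + 1) (by lia) hB.globalDimension_eq,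
    fun Y hY hYi => ?_⟩
  have : IsNoetherianRing (OnePointExtension k B M) := IsNoetherianRing.of_finite k _
  let ε := OnePointExtension.equivTriple k B M Y
  have : Module.Finite (OnePointExtension k B M)
      (OnePointExtension.Triple (OnePointExtension.structureMap k B M Y)) :=
    Module.Finite.equiv ε
  have := OnePointExtension.Triple.finite_elt (OnePointExtension.structureMap k B M Y)
  have := OnePointExtension.Triple.finite_vec (OnePointExtension.structureMap k B M Y)
  let e := (Module.finBasis k (OnePointExtension.ptPart k B M Y)).equivFun.symm
  let f := OnePointExtension.structureMap k B M Y ∘ₗ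
    AlgebraTensorModule.lTensor B M e.toLinearMap
  let η : ModuleCat.of (OnePointExtension k B M) (OnePointExtension.Triple f) ≅ Y :=
    ((OnePointExtension.Triple.congrVec (OnePointExtension.structureMap k B M Y) e).trans
      ε.symm).toModuleIso
  refine (h _ _ f (hYi.of_iso η.symm)).imp (fun hp => ?_) fun hi => ?_
  · have := (projectiveDimension_le_iff _ m).1 hp
    have := OnePointExtension.hasProjectiveDimensionLE_triple f m hm
    exact (projectiveDimension_le_iff Y m).2 (hasProjectiveDimensionLT_of_iso η (m + 1))
  · have := (injectiveDimension_le_iff _ 1).1 hi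
    have := OnePointExtension.hasInjectiveDimensionLE_triple f 1 le_rfl
    exact (injectiveDimension_le_iff Y 1).2 (hasInjectiveDimensionLT_of_iso η 2)
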